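/- Let $n \ge 0$ and let $S_n$ be the lattice of permutations $x = x_1 x_2 \cdots x_n$ of $\{1,\dots,n\}$ under the weak order, i.e. the partial order whose cover relations are $x \lessdot y$ whenever $y$ is obtained from $x$ by swapping two adjacent entries $x_i < x_{i+1}$. A (lattice) congruence on $S_n$ is an equivalence relation respecting meets and joins; it contracts an element $x$ if $x$ is congruent to some element strictly below $x$. For $1 \le a < b \le n$ and $R \subseteq \{a+1,\dots,b-1\}$, put $L = \{a+1,\dots,b-1\} \setminus R$. Let $\lambda(b,a,R)$ be the (join-irreducible) permutation whose one-line notation consists of $1,\dots,a-1$, then the elements of $L$ in increasing order, then $b$, then $a$, then the elements of $R$ in increasing order, then $b+1,\dots,n$. A permutation $x$ has a $(b,a,R)$-pattern if there is an index $i$ with $x_i > x_{i+1}$, $x_i \ge b$ and $x_{i+1} \le a$ such that all elements of $L$ appear in $x$ to the left of $x_i x_{i+1}$ and all elements of $R$ appear in $x$ to the right of $x_i x_{i+1}$; otherwise $x$ avoids $(b,a,R)$. Let $(b_i,a_i,R_i)_{i\in I}$ be any family of such triples. Then there is a smallest congruence $\Theta$ on $S_n$ (with respect to containment of relations) contracting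 all the permutations $\lambda(b_i,a_i,R_i)$, $i \in I$, and the permutations not contracted by $\Theta$ are exactly the permutations that avoid $(b_i,a_i,R_i)$ for every $i \in I$. -/

import Mathlib

/-- Permutations of an `n`-element chain (values and positions are both `Fin n`), written in
one-line notation; the entry in position `i` is `x.perm i`.  A separate structure is used so that
this type can carry the weak order. -/
@[ext]
structure WeakPerm (n : ℕ) where
  perm : Equiv.Perm (Fin n)

namespace WeakPerm

variable {n : ℕ}

/-- The entry `x_i` in position `i`. -/
def entry (x : WeakPerm n) (i : Fin n) : Fin n := x.perm i

/-- The position of the value `v`. -/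
def pos (x : WeakPerm n) (v : Fin n) : Fin n := x.perm.symm v

@[simp] theorem pos_entry (x : WeakPerm n) (i : Fin n) : x.pos (x.entry i) = i := by
  simp [pos, entry]

@[simp] theorem entry_pos (x : WeakPerm n) (v : Fin n) : x.entry (x.pos v) = v := by
  simp [pos, entry]

theorem entry_inj (x : WeakPerm n) {i j : Fin n} : x.entry i = x.entry j ↔ i = j := by
  simp [entry]

theorem pos_inj (x : WeakPerm n) {i j : Fin n} : x.pos i = x.pos j ↔ i = j := by
  simp [pos]

/-- The covering relation of the weak order: `y` is obtained from `x` by swapping two adjacent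
entries `x_i < x_{i+1}`, i.e. `x_i = y_{i+1} < y_i = x_{i+1}` and `x_k = y_k` for all other `k`. -/
def Step (x y : WeakPerm n) : Prop :=
  ∃ i j : Fin n, i.val + 1 = j.val ∧
    x.entry i = y.entry j ∧ y.entry j < y.entry i ∧ y.entry i = x.entry j ∧
    ∀ k, k ≠ i → k ≠ j → x.entry k = y.entry k

/-- `(b, a)` is an inversion of `x`: `b > a` and `b` occurs to the left of `a`. -/
def IsInv (x : WeakPerm n) (b a : Fin n) : Prop := a < b ∧ x.pos b < x.pos a

theorem ext_pos {x y : WeakPerm n} (h : ∀ v, x.pos v = y.pos v) : x = y := by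
  have : x.perm.symm = y.perm.symm := Equiv.ext h
  ext1
  simpa using congrArg Equiv.symm this

/-- Passing from `x` to `y` by a step adds exactly one inversion. -/
theorem Step.isInv_iff {x y : WeakPerm n} {i j : Fin n} (hij : i.val + 1 = j.val)
    (h1 : x.entry i = y.entry j) (h2 : y.entry j < y.entry i) (h3 : y.entry i = x.entry j)
    (h4 : ∀ k, k ≠ i → k ≠ j → x.entry k = y.entry k) (b a : Fin n) :
    y.IsInv b a ↔ x.IsInv b a ∨ (b = x.entry j ∧ a = x.entry i) := by
  have hpos : ∀ k, y.pos (x.entry k) = Equiv.swap i j k := by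
    intro k
    by_cases hki : k = i
    · subst hki; rw [h1, pos_entry, Equiv.swap_apply_left]
    by_cases hkj : k = j
    · subst hkj; rw [← h3, pos_entry, Equiv.swap_apply_right]
    rw [h4 k hki hkj, pos_entry, Equiv.swap_apply_of_ne_of_ne hki hkj]
  obtain ⟨p, rfl⟩ : ∃ p, b = x.entry p := ⟨x.pos b, by simp⟩
  obtain ⟨q, rfl⟩ : ∃ q, a = x.entry q := ⟨x.pos a, by simp⟩
  have hlt : x.entry i < x.entry j := by rw [h1, ← h3]; exact h2
  simp only [IsInv, hpos, pos_entry, entry_inj]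
  by_cases hp : p = i <;> by_cases hq : q = j
  · subst hp hq
    have hpq : p < q := by simp only [Fin.lt_def]; omega
    simp [hlt.not_gt, hpq.ne]
  · by_cases hqi : q = i
    · subst hqi; subst hp
      simp
      intro h; subst h; simp at hlt
    · subst hp
      rw [Equiv.swap_apply_left, Equiv.swap_apply_of_ne_of_ne hqi hq]
      have : q ≠ p := hqi
      simp only [hqi, and_false, or_false]
      have : (j < q ↔ p < q) := by
        have : q.val ≠ j.val := fun h => hq (Fin.ext h)
        simp only [Fin.lt_def]; omega
      rw [this]
  · by_cases hpj : p = j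
    · subst hpj; subst hq
      simp
      exact fun h => hp h
    · subst hq
      rw [Equiv.swap_apply_right, Equiv.swap_apply_of_ne_of_ne hp hpj]
      simp only [hpj, false_and, or_false]
      have : (p < i ↔ p < q) := by
        have : p.val ≠ i.val := fun h => hp (Fin.ext h)
        simp only [Fin.lt_def]; omega
      rw [this]
  · by_cases hpj : p = j
    · by_cases hqi : q = i
      · subst hpj; subst hqi
        have : q < p := by simp only [Fin.lt_def]; omega
        simp [hlt, this]
      · subst hpj
        rw [Equiv.swap_apply_right, Equiv.swap_apply_of_ne_of_ne hqi hq]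
        simp only [hqi, and_false, or_false]
        have : (i < q ↔ p < q) := by
          have : q.val ≠ p.val := fun h => hq (Fin.ext h)
          simp only [Fin.lt_def]; omega
        rw [this]
    · rw [Equiv.swap_apply_of_ne_of_ne hp hpj]
      simp only [hpj, false_and, or_false]
      by_cases hqi : q = i
      · subst hqi
        rw [Equiv.swap_apply_left]
        have : (p < j ↔ p < q) := by
          have : p.val ≠ q.val := fun h => hp (Fin.ext h)
          simp only [Fin.lt_def]; omega
        rw [this]
      · rw [Equiv.swap_apply_of_ne_of_ne hqi hq]

theorem Step.isInv_mono {x y : WeakPerm n} (h : Step x y) {b a : Fin n} (hx : x.IsInv b a) :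
    y.IsInv b a := by
  obtain ⟨i, j, hij, h1, h2, h3, h4⟩ := h
  exact (Step.isInv_iff hij h1 h2 h3 h4 b a).2 (Or.inl hx)

theorem eq_of_forall_adj {x y : WeakPerm n}
    (h : ∀ i j : Fin n, i.val + 1 = j.val → y.pos (x.entry i) < y.pos (x.entry j)) : x = y := by
  have hmono : StrictMono fun i => y.pos (x.entry i) := by
    cases n with
    | zero => intro i; exact i.elim0
    | succ m =>
      rw [Fin.strictMono_iff_lt_succ]
      intro i
      exact h _ _ (by simp)
  have hid : ∀ i, y.pos (x.entry i) = i := by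
    have hsurj : Function.Surjective fun i => y.pos (x.entry i) :=
      fun k => ⟨x.pos (y.entry k), by simp⟩
    intro i
    have := Subsingleton.elim (hmono.orderIsoOfSurjective _ hsurj) (OrderIso.refl (Fin n))
    exact congrArg (fun f : Fin n ≃o Fin n => f i) this
  apply ext_pos
  intro v
  have := hid (x.pos v)
  rw [entry_pos] at this
  exact this.symm

/-- The weak order is containment of inversion sets. -/
theorem reflTransGen_step_iff {x y : WeakPerm n} :
    Relation.ReflTransGen Step x y ↔ ∀ b a, x.IsInv b a → y.IsInv b a := by
  classical
  constructor
  · intro h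
    induction h with
    | refl => exact fun _ _ h => h
    | tail _ hs ih => exact fun b a hx => hs.isInv_mono (ih b a hx)
  · intro h
    generalize hN : (Finset.univ.filter fun p : Fin n × Fin n =>
      y.IsInv p.1 p.2 ∧ ¬ x.IsInv p.1 p.2).card = N
    induction N using Nat.strong_induction_on generalizing x with
    | _ N ih =>
    by_cases hxy : x = y
    · rw [hxy]
    have hex : ∃ i j : Fin n, i.val + 1 = j.val ∧ ¬ y.pos (x.entry i) < y.pos (x.entry j) := by
      by_contra hne
      push Not at hne
      exact hxy (eq_of_forall_adj hne)
    obtain ⟨i, j, hij, hnot⟩ := hex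
    have hlt : i < j := by simp only [Fin.lt_def]; omega
    have hne : i ≠ j := hlt.ne
    have hasc : x.entry i < x.entry j := by
      rcases lt_trichotomy (x.entry i) (x.entry j) with h' | h' | h'
      · exact h'
      · exact absurd (x.entry_inj.1 h') hne
      · exact absurd (h _ _ ⟨h', by simpa using hlt⟩).2 hnot
    have hyinv : y.IsInv (x.entry j) (x.entry i) := by
      refine ⟨hasc, lt_of_le_of_ne (not_lt.1 hnot) ?_⟩
      rw [Ne, pos_inj, entry_inj]
      exact hne.symm
    let z : WeakPerm n := ⟨(Equiv.swap i j).trans x.perm⟩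
    have hz : ∀ k, z.entry k = x.entry (Equiv.swap i j k) := fun k => rfl
    have h1 : x.entry i = z.entry j := by rw [hz, Equiv.swap_apply_right]
    have h3 : z.entry i = x.entry j := by rw [hz, Equiv.swap_apply_left]
    have h2 : z.entry j < z.entry i := by rw [← h1, h3]; exact hasc
    have h4 : ∀ k, k ≠ i → k ≠ j → x.entry k = z.entry k := fun k hk hk' => by
      rw [hz, Equiv.swap_apply_of_ne_of_ne hk hk']
    have hzi := Step.isInv_iff hij h1 h2 h3 h4
    refine Relation.ReflTransGen.head (b := z) ⟨i, j, hij, h1, h2, h3, h4⟩ ?_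
    refine ih _ ?_ ?_ rfl
    · rw [← hN]
      apply Finset.card_lt_card
      rw [Finset.ssubset_iff_of_subset]
      · refine ⟨(x.entry j, x.entry i), ?_, ?_⟩
        · simp only [Finset.mem_filter, Finset.mem_univ, true_and]
          refine ⟨hyinv, fun hh => ?_⟩
          have := hh.2
          simp only [pos_entry] at this
          exact absurd this hlt.not_gt
        · simp only [Finset.mem_filter, Finset.mem_univ, true_and, not_and, not_not]
          exact fun _ => (hzi _ _).2 (Or.inr ⟨rfl, rfl⟩)
      · intro p
        simp only [Finset.mem_filter, Finset.mem_univ, true_and]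
        exact fun hp => ⟨hp.1, fun hx => hp.2 ((hzi _ _).2 (Or.inl hx))⟩
    · intro b a hza
      rcases (hzi b a).1 hza with hx | ⟨rfl, rfl⟩
      · exact h b a hx
      · exact hyinv

theorem eq_of_isInv_iff {x y : WeakPerm n} (h : ∀ b a, x.IsInv b a ↔ y.IsInv b a) : x = y := by
  apply eq_of_forall_adj
  intro i j hij
  have hlt : i < j := by simp only [Fin.lt_def]; omega
  rcases lt_trichotomy (x.entry i) (x.entry j) with h' | h' | h'
  · by_contra hn
    have : y.IsInv (x.entry j) (x.entry i) := by
      refine ⟨h', lt_of_le_of_ne (not_lt.1 hn) ?_⟩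
      rw [Ne, pos_inj, entry_inj]
      exact hlt.ne'
    have := ((h _ _).2 this).2
    simp only [pos_entry] at this
    exact absurd this hlt.not_gt
  · exact absurd (x.entry_inj.1 h') hlt.ne
  · exact ((h _ _).1 ⟨h', by simpa using hlt⟩).2

/-- The weak order: the partial order generated by the covering relation `Step`. -/
instance : PartialOrder (WeakPerm n) where
  le x y := Relation.ReflTransGen Step x y
  le_refl _ := Relation.ReflTransGen.refl
  le_trans _ _ _ h h' := h.trans h'
  le_antisymm _ _ h h' := eq_of_isInv_iff fun b a =>
    ⟨reflTransGen_step_iff.1 h b a, reflTransGen_step_iff.1 h' b a⟩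

theorem le_iff {x y : WeakPerm n} : x ≤ y ↔ ∀ b a, x.IsInv b a → y.IsInv b a :=
  reflTransGen_step_iff

theorem exists_equiv_fin_of_strictTotal {α : Type} [Fintype α] (hc : Fintype.card α = n)
    (r : α → α → Prop) (hirr : ∀ a, ¬ r a a) (htr : ∀ a b c, r a b → r b c → r a c)
    (htot : ∀ a b, a ≠ b → r a b ∨ r b a) :
    ∃ e : α ≃ Fin n, ∀ u v, e u < e v ↔ r u v := by
  classical
  let lo : LinearOrder α :=
    { le := fun a b => a = b ∨ r a b
      lt := r
      le_refl := fun a => Or.inl rfl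
      le_trans := by
        rintro a b c (rfl | h) (rfl | h')
        · exact Or.inl rfl
        · exact Or.inr h'
        · exact Or.inr h
        · exact Or.inr (htr _ _ _ h h')
      le_antisymm := by
        rintro a b (rfl | h) (h' | h')
        · rfl
        · rfl
        · exact h'.symm
        · exact absurd (htr _ _ _ h h') (hirr _)
      le_total := by
        intro a b
        by_cases hab : a = b
        · exact Or.inl (Or.inl hab)
        · rcases htot a b hab with h | h
          · exact Or.inl (Or.inr h)
          · exact Or.inr (Or.inr h)
      lt_iff_le_not_ge := by
        intro a b
        constructor
        · refine fun h => ⟨Or.inr h, ?_⟩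
          rintro (rfl | h')
          · exact hirr _ h
          · exact hirr _ (htr _ _ _ h h')
        · rintro ⟨rfl | h, h'⟩
          · exact absurd (Or.inl rfl) h'
          · exact h
      toDecidableLE := Classical.decRel _ }
  let e := (Fintype.orderIsoFinOfCardEq α hc).symm
  exact ⟨e.toEquiv, fun u v => e.lt_iff_lt⟩

/-- Every set of permutations has a join in the weak order; its inversion set is the transitive
closure of the union of the inversion sets. -/
theorem exists_isLUB (S : Set (WeakPerm n)) : ∃ z, IsLUB S z := by
  classical
  let U : Fin n → Fin n → Prop := fun b a => ∃ x ∈ S, x.IsInv b a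
  let T : Fin n → Fin n → Prop := Relation.TransGen U
  have hTlt : ∀ {b a}, T b a → a < b := by
    intro b a h
    induction h with
    | single h => obtain ⟨x, _, h⟩ := h; exact h.1
    | tail _ h ih => obtain ⟨x, _, h⟩ := h; exact h.1.trans ih
  have hco : ∀ {b a}, T b a → ∀ c, c < b → a < c → T b c ∨ T c a := by
    have hU : ∀ {b a}, U b a → ∀ c, c < b → a < c → T b c ∨ T c a := by
      rintro b a ⟨x, hx, hba⟩ c hcb hac
      rcases lt_or_ge (x.pos b) (x.pos c) with h | h
      · exact Or.inl (.single ⟨x, hx, hcb, h⟩)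
      · exact Or.inr (.single ⟨x, hx, hac, h.trans_lt hba.2⟩)
    intro b a h
    induction h using Relation.TransGen.head_induction_on with
    | single h => exact hU h
    | head h h' ih =>
      rename_i b b'
      intro c hcb hac
      rcases lt_trichotomy c b' with hc | rfl | hc
      · rcases ih c hc hac with h1 | h1
        · exact Or.inl (Relation.TransGen.head h h1)
        · exact Or.inr h1
      · exact Or.inl (.single h)
      · rcases hU h c hcb hc with h1 | h1
        · exact Or.inl h1
        · exact Or.inr (h1.trans h')
  let r : Fin n → Fin n → Prop := fun u v => (u < v ∧ ¬ T v u) ∨ T u v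
  obtain ⟨e, he⟩ := exists_equiv_fin_of_strictTotal (Fintype.card_fin n) r
    (by
      rintro a (h | h)
      · exact lt_irrefl _ h.1
      · exact lt_irrefl _ (hTlt h))
    (by
      rintro a b c (⟨h1, h2⟩ | h1) (⟨h3, h4⟩ | h3)
      · refine Or.inl ⟨h1.trans h3, fun h => ?_⟩
        rcases hco h b h3 h1 with h' | h'
        · exact h4 h'
        · exact h2 h'
      · have hcb := hTlt h3
        rcases lt_trichotomy a c with h | rfl | h
        · exact Or.inl ⟨h, fun h' => h2 (h3.trans h')⟩
        · exact absurd h3 h2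
        · rcases hco h3 a h1 h with h' | h'
          · exact absurd h' h2
          · exact Or.inr h'
      · have hba := hTlt h1
        rcases lt_trichotomy a c with h | rfl | h
        · exact Or.inl ⟨h, fun h' => h4 (h'.trans h1)⟩
        · exact absurd h1 h4
        · rcases hco h1 c h h3 with h' | h'
          · exact Or.inr h'
          · exact absurd h' h4
      · exact Or.inr (h1.trans h3))
    (by
      intro a b hab
      rcases lt_or_gt_of_ne hab with h | h
      · by_cases hT : T b a
        · exact Or.inr (Or.inr hT)
        · exact Or.inl (Or.inl ⟨h, hT⟩)
      · by_cases hT : T a b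
        · exact Or.inl (Or.inr hT)
        · exact Or.inr (Or.inl ⟨h, hT⟩))
  let z : WeakPerm n := ⟨e.symm⟩
  have hz : ∀ b a, z.IsInv b a ↔ T b a := by
    intro b a
    have : z.IsInv b a ↔ a < b ∧ r b a := and_congr Iff.rfl (he b a)
    rw [this]
    constructor
    · rintro ⟨h, h' | h'⟩
      · exact absurd h h'.1.not_gt
      · exact h'
    · exact fun h => ⟨hTlt h, Or.inr h⟩
  refine ⟨z, fun x hx => le_iff.2 fun b a h => (hz b a).2 (.single ⟨x, hx, h⟩), fun w hw => ?_⟩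
  refine le_iff.2 fun b a h => ?_
  replace h : T b a := (hz b a).1 h
  clear_value z
  induction h with
  | single h => obtain ⟨x, hx, h⟩ := h; exact le_iff.1 (hw hx) _ _ h
  | tail h1 h ih =>
    obtain ⟨x, hx, h⟩ := h
    have h := le_iff.1 (hw hx) _ _ h
    exact ⟨h.1.trans ih.1, ih.2.trans h.2⟩

/-- The weak order is a lattice.  Meets and joins are the greatest lower bounds and least upper
bounds in the weak order. -/
noncomputable instance : Lattice (WeakPerm n) :=
  let _ : SupSet (WeakPerm n) := ⟨fun S => (exists_isLUB S).choose⟩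
  (completeLatticeOfSup (WeakPerm n) fun S => (exists_isLUB S).choose_spec).toLattice

/-- `x` is contracted by the lattice congruence `Θ` if it is congruent to an element (strictly)
below it. -/
def Contracted (Θ : LatticeCon (WeakPerm n)) (x : WeakPerm n) : Prop :=
  ∃ y, y < x ∧ Θ.r x y

/-- `Θ` is the smallest congruence (as a relation, i.e. with respect to containment) among the
lattice congruences on the weak order that contract every element of `J`. -/
def IsSmallestContracting (Θ : LatticeCon (WeakPerm n)) (J : Set (WeakPerm n)) : Prop :=
  (∀ j ∈ J, Contracted Θ j) ∧
    ∀ Θ' : LatticeCon (WeakPerm n), (∀ j ∈ J, Contracted Θ' j) → ∀ x y, Θ.r x y → Θ'.r x y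

end WeakPerm

/-- The triples `(b, a, R)` with `a < b` and `R ⊆ {a + 1, …, b - 1}`. -/
structure ArcTriple (n : ℕ) where
  b : Fin n
  a : Fin n
  R : Finset (Fin n)
  a_lt_b : a < b
  R_subset : R ⊆ Finset.Ioo a b

namespace ArcTriple

variable {n : ℕ}

/-- `L = {a + 1, …, b - 1} \ R`. -/
def L (t : ArcTriple n) : Finset (Fin n) := Finset.Ioo t.a t.b \ t.R

/-- The one-line word of `λ(b, a, R)`: the values below `a`, then `L` in increasing order, then
`b`, then `a`, then `R` in increasing order, and finally the values above `b`. -/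
def word (t : ArcTriple n) : List (Fin n) :=
  (Finset.Iio t.a).sort ++ t.L.sort ++ [t.b, t.a] ++ t.R.sort ++ (Finset.Ioi t.b).sort

theorem mem_word (t : ArcTriple n) (v : Fin n) : v ∈ t.word := by
  simp only [word, L, List.mem_append, Finset.mem_sort, Finset.mem_Iio, Finset.mem_sdiff,
    Finset.mem_Ioo, List.mem_cons, List.not_mem_nil, or_false, Finset.mem_Ioi]
  by_cases h : v ∈ t.R
  · simp [h]
  · rcases lt_trichotomy v t.a with h1 | h1 | h1 <;> rcases lt_trichotomy v t.b with h2 | h2 | h2 <;>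
      simp [*]

theorem nodup_word (t : ArcTriple n) : t.word.Nodup := by
  have hab := t.a_lt_b
  have hR : ∀ v ∈ t.R, t.a < v ∧ v < t.b := fun v hv => Finset.mem_Ioo.1 (t.R_subset hv)
  simp only [word, L, List.nodup_append, Finset.sort_nodup, List.mem_append, Finset.mem_sort,
    Finset.mem_Iio, Finset.mem_sdiff, Finset.mem_Ioo, List.mem_cons, List.not_mem_nil, or_false,
    Finset.mem_Ioi, List.nodup_cons, List.nodup_nil, true_and, and_true, not_false_eq_true]
  grind

theorem length_word (t : ArcTriple n) : t.word.length = n := by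
  have h := List.toFinset_card_of_nodup t.nodup_word
  rw [← h, show t.word.toFinset = Finset.univ from
    Finset.eq_univ_of_forall fun v => List.mem_toFinset.2 (t.mem_word v), Finset.card_univ,
    Fintype.card_fin]

/-- The join-irreducible permutation `λ(b, a, R)`, with one-line notation `t.word`. -/
def joinIrr (t : ArcTriple n) : WeakPerm n :=
  ⟨(finCongr t.length_word.symm).trans
    (List.Nodup.getEquivOfForallMemList t.word t.nodup_word t.mem_word)⟩

end ArcTriple

namespace WeakPerm

variable {n : ℕ}

/-- `x` has a `(b, a, R)`-pattern: there is a descent `x_i > x_{i+1}` with `x_i ≥ b` and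
`x_{i+1} ≤ a` such that every element of `L` occurs in `x` to the left, and every element of `R`
to the right, of the two entries `x_i, x_{i+1}`. -/
def HasPattern (x : WeakPerm n) (t : ArcTriple n) : Prop :=
  ∃ i j : Fin n, i.val + 1 = j.val ∧ x.entry j < x.entry i ∧
    t.b ≤ x.entry i ∧ x.entry j ≤ t.a ∧
    (∀ c ∈ t.L, x.pos c < i) ∧ ∀ c ∈ t.R, j < x.pos c

/-- `x` avoids `(b, a, R)` if it has no `(b, a, R)`-pattern. -/
def Avoids (x : WeakPerm n) (t : ArcTriple n) : Prop := ¬ x.HasPattern t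

end WeakPerm

/-!
The covers `y ⋖ x` of the weak order are labelled by triples: a cover that removes the descent `b
a` of `x` gets the label `(b, a, R)`, where `R` is the set of values between `a` and `b` standing
to the right of the descent. Triples are preordered by the subarc relation (`t ≤ u` if `u`
restricts to `t`), and `x` has a `t`-pattern exactly when `t` is a subarc of the label of some
cover below `x` (`WeakPerm.hasPattern_iff`). The theorem therefore says that the smallest
congruence contracting the given `λ(t i)` collapses exactly the covers whose label lies in the
upper set `C` generated by the `t i`. There are two halves.

*The covers with label in `C` can be collapsed without collapsing others.* Let `Sim C` relate two
permutations that lie above the same `λ(t)`, `t ∉ C`. It is compatible with meets by definition,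
and it collapses a cover if and only if the label is in `C` (`WeakPerm.sim_iff_of_edge`). Reading
permutations backwards is an anti-automorphism of the weak order that exchanges left and right in
the labels. As relations of this kind are determined by the covers they collapse, it carries `Sim
C` to such a relation (`WeakPerm.Sim.rev`), so `Sim C` is compatible with joins too and is a
congruence (`WeakPerm.con`).

*All these covers have to be collapsed.* A congruence contracts `λ(t)` if and only if it collapses
one cover labelled `t`, and then it collapses all of them (`WeakPerm.Edge.contracted_of_rel`,
`WeakPerm.Contracted.rel_of_edge`). Contraction passes from an arc to those containing it: moving
one endpoint at a time, joins or meets of suitable permutations with two congruent ones show that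
a cover with the larger label is collapsed (`WeakPerm.Contracted.of_le_of_join`,
`WeakPerm.Contracted.of_le_of_meet`, `WeakPerm.Contracted.of_le`).
-/

/-! ### Permutations given by increasing blocks -/

namespace WeakPerm

variable {n : ℕ}

/-- Permutations given by blocks: `c` assigns a block number to each value, blocks are written in
increasing order of their number, and the values inside a block are written in increasing order. -/
theorem exists_isInv_iff_blocks (c : Fin n → ℕ) :
    ∃ x : WeakPerm n, ∀ b a, x.IsInv b a ↔ a < b ∧ c b < c a := by
  obtain ⟨e, he⟩ := exists_equiv_fin_of_strictTotal (Fintype.card_fin n)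
    (fun u v => c u < c v ∨ (c u = c v ∧ u < v)) (by grind) (by grind) (by grind)
  refine ⟨⟨e.symm⟩, fun b a => and_congr_right fun hab => (he b a).trans ?_⟩
  grind

theorem isInv_of_not_isInv {x : WeakPerm n} {b a : Fin n} (hab : a < b) (h : ¬ x.IsInv b a) :
    x.pos a < x.pos b := by
  have := x.pos_inj (i := a) (j := b)
  unfold IsInv at h
  grind

end WeakPerm

/-! ### Arcs, subarcs and the inversions of the join-irreducibles -/

namespace ArcTriple

variable {n : ℕ}

theorem mem_L {t : ArcTriple n} {v : Fin n} : v ∈ t.L ↔ t.a < v ∧ v < t.b ∧ v ∉ t.R := by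
  simp [L, and_assoc]

theorem lt_of_mem_R {t : ArcTriple n} {v : Fin n} (h : v ∈ t.R) : t.a < v ∧ v < t.b :=
  Finset.mem_Ioo.1 (t.R_subset h)

/-- The position of `v` in the division of the word of `λ(b, a, R)` into increasing blocks:
`1 ⋯ (a - 1)`, then `L`, `b`, `a`, `R`, and `(b + 1) ⋯ n`. -/
def block (t : ArcTriple n) (v : Fin n) : ℕ :=
  if v < t.a then 0 else if t.b < v then 5 else if v = t.a then 3 else if v = t.b then 2
  else if v ∈ t.R then 4 else 1

theorem word_pairwise (t : ArcTriple n) : t.word.Pairwise fun u v =>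
    t.block u < t.block v ∨ (t.block u = t.block v ∧ u < v) := by
  have hab := t.a_lt_b
  have hR := fun v => @lt_of_mem_R _ t v
  have hs : ∀ s : Finset (Fin n), s.sort.Pairwise (· < ·) := fun s => s.sortedLT_sort.pairwise
  simp only [word, List.pairwise_append, List.mem_append, Finset.mem_sort, List.mem_cons,
    List.not_mem_nil, or_false, Finset.mem_Iio, Finset.mem_Ioi, mem_L, List.pairwise_cons,
    List.Pairwise.nil, and_true]
  refine ⟨⟨⟨⟨?_, ?_, ?_⟩, ?_, ?_⟩, ?_, ?_⟩, ?_, ?_⟩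
  all_goals first
    | (refine List.Pairwise.imp_of_mem ?_ (hs _)
       simp only [Finset.mem_sort, Finset.mem_Iio, Finset.mem_Ioi, mem_L, block]
       grind)
    | (simp only [block]; grind)

theorem joinIrr_isInv {t : ArcTriple n} {v w : Fin n} :
    t.joinIrr.IsInv v w ↔ w < v ∧ t.block v < t.block w := by
  have key : ∀ i j : Fin n, i < j → t.block (t.joinIrr.entry i) < t.block (t.joinIrr.entry j) ∨
      (t.block (t.joinIrr.entry i) = t.block (t.joinIrr.entry j) ∧
        t.joinIrr.entry i < t.joinIrr.entry j) := fun i j hij =>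
    List.pairwise_iff_getElem.1 t.word_pairwise i j (by simp [length_word])
      (by simp [length_word]) hij
  have h1 := key (t.joinIrr.pos v) (t.joinIrr.pos w)
  have h2 := key (t.joinIrr.pos w) (t.joinIrr.pos v)
  have := t.joinIrr.pos_inj (i := v) (j := w)
  simp only [WeakPerm.entry_pos] at h1 h2
  unfold WeakPerm.IsInv
  grind

/-- The subarc order: `t ≤ u` if the interval of `t` lies in that of `u` and the splitting of the
values strictly inside `t` into left and right is the one that `u` induces. -/
instance : Preorder (ArcTriple n) where
  le t u := u.a ≤ t.a ∧ t.b ≤ u.b ∧ t.L ⊆ u.L ∧ t.R ⊆ u.R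
  le_refl _ := ⟨le_rfl, le_rfl, subset_rfl, subset_rfl⟩
  le_trans _ _ _ h h' :=
    ⟨h'.1.trans h.1, h.2.1.trans h'.2.1, h.2.2.1.trans h'.2.2.1, h.2.2.2.trans h'.2.2.2⟩

/-- The inversions of `λ(b, a, R)` are the pairs `l > r` with `l ∈ L ∪ {b}` and `r ∈ R ∪ {a}`. -/
theorem joinIrr_le_iff {t : ArcTriple n} {x : WeakPerm n} : t.joinIrr ≤ x ↔
    ∀ l r, (l ∈ t.L ∨ l = t.b) → (r ∈ t.R ∨ r = t.a) → r < l → x.IsInv l r := by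
  have hab := t.a_lt_b
  have hR := fun v => @lt_of_mem_R _ t v
  have hL := fun v => @mem_L _ t v
  rw [WeakPerm.le_iff]
  simp only [joinIrr_isInv]
  constructor
  · intro h l r hl hr hlr
    refine h l r ⟨hlr, ?_⟩
    unfold block
    grind
  · intro h l r ⟨hlr, hb⟩
    refine h l r ?_ ?_ hlr
    all_goals
      unfold block at hb
      grind

/-- The triple `(b, a, L)`, with left and right exchanged. -/
def flip (t : ArcTriple n) : ArcTriple n := ⟨t.b, t.a, t.L, t.a_lt_b, Finset.sdiff_subset⟩

theorem mem_flip_L {t : ArcTriple n} {v : Fin n} : v ∈ t.flip.L ↔ v ∈ t.R := by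
  have := @lt_of_mem_R _ t v
  simp only [mem_L, flip]
  grind

@[simp] theorem flip_flip (t : ArcTriple n) : t.flip.flip = t := by
  have : t.flip.L = t.R := Finset.ext fun v => mem_flip_L
  cases t
  simp only [flip, mk.injEq, true_and]
  exact this

theorem flip_le_flip {t u : ArcTriple n} (h : t ≤ u) : t.flip ≤ u.flip :=
  ⟨h.1, h.2.1, fun _ hv => mem_flip_L.2 (h.2.2.2 (mem_flip_L.1 hv)), h.2.2.1⟩

end ArcTriple

namespace WeakPerm

variable {n : ℕ}

/-! ### Edges of the weak order and their labels -/

/-- `y ⋖ x` is a covering pair labelled by `t = (b, a, R)`: `x` is obtained from `y` by reversing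
the pair `a, b`, and in `x` the values of `L` stand to the left and those of `R` to the right of
both. The cover relation is expressed by inversion sets, without naming positions. -/
structure Edge (t : ArcTriple n) (y x : WeakPerm n) : Prop where
  isInv_iff : ∀ v w, x.IsInv v w ↔ y.IsInv v w ∨ (v = t.b ∧ w = t.a)
  not_isInv : ¬ y.IsInv t.b t.a
  left : ∀ l ∈ t.L, x.pos l < x.pos t.b
  right : ∀ r ∈ t.R, x.pos t.a < x.pos r

theorem Edge.le {t : ArcTriple n} {y x : WeakPerm n} (h : Edge t y x) : y ≤ x :=
  le_iff.2 fun v w hv => (h.isInv_iff v w).2 (Or.inl hv)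

theorem Edge.isInv {t : ArcTriple n} {y x : WeakPerm n} (h : Edge t y x) : x.IsInv t.b t.a :=
  (h.isInv_iff _ _).2 (Or.inr ⟨rfl, rfl⟩)

theorem Edge.joinIrr_le {t : ArcTriple n} {y x : WeakPerm n} (h : Edge t y x) :
    t.joinIrr ≤ x := by
  rw [ArcTriple.joinIrr_le_iff]
  have hx := h.isInv
  have h1 := h.right
  have h2 := h.left
  unfold IsInv at *
  grind

theorem not_joinIrr_le {t : ArcTriple n} {y : WeakPerm n} (h : ¬ y.IsInv t.b t.a) :
    ¬ t.joinIrr ≤ y := fun hle =>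
  h (ArcTriple.joinIrr_le_iff.1 hle _ _ (Or.inr rfl) (Or.inr rfl) t.a_lt_b)

/-- The permutations `x` and `y` lie above the same join-irreducibles `λ(t)` with `t ∉ C`. For an
upper set `C` of the subarc order this is the congruence that contracts exactly the `λ(t)`, `t ∈
C`. -/
def Sim (C : Set (ArcTriple n)) (x y : WeakPerm n) : Prop :=
  ∀ t ∉ C, t.joinIrr ≤ x ↔ t.joinIrr ≤ y

/-- An edge is collapsed exactly when its label lies in `C`. If a join-irreducible `λ(u)` is below
`x` but not below `y`, it uses the pair on which `x` and `y` differ; since the two values are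
adjacent in `x`, the label of the edge is a subarc of `u`. -/
theorem sim_iff_of_edge {C : Set (ArcTriple n)} (hC : IsUpperSet C)
    {t : ArcTriple n} {y x : WeakPerm n} (h : Edge t y x) : Sim C y x ↔ t ∈ C := by
  constructor
  · intro hs
    by_contra ht
    exact not_joinIrr_le h.not_isInv ((hs t ht).2 h.joinIrr_le)
  · intro ht u hu
    refine ⟨fun h' => h'.trans h.le, fun hux => ?_⟩
    by_contra huy
    apply hu
    refine hC ?_ ht
    rw [ArcTriple.joinIrr_le_iff] at hux huy
    push Not at huy
    obtain ⟨l, r, hl, hr, hrl, hy⟩ := huy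
    obtain ⟨rfl, rfl⟩ : l = t.b ∧ r = t.a :=
      ((h.isInv_iff l r).1 (hux l r hl hr hrl)).resolve_left hy
    have huL := fun v => @ArcTriple.mem_L _ u v
    have huR := fun v => @ArcTriple.lt_of_mem_R _ u v
    have htL := fun v => @ArcTriple.mem_L _ t v
    have htR := fun v => @ArcTriple.lt_of_mem_R _ t v
    have huab := u.a_lt_b
    have hx1 := h.right
    have hx2 := h.left
    have hinv := h.isInv
    refine ⟨by grind, by grind, fun v hv => ?_, fun v hv => ?_⟩
    · rw [huL]
      have := hux t.b v hl
      unfold IsInv at *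
      grind
    · by_contra hvR
      have := hux v t.a
      unfold IsInv at *
      grind

/-! ### The reversal anti-automorphism -/

/-- The one-line notation of `x` read from right to left. This is an anti-automorphism of the weak
order. -/
def rev (x : WeakPerm n) : WeakPerm n := ⟨Fin.revPerm.trans x.perm⟩

theorem pos_rev (x : WeakPerm n) (v : Fin n) : x.rev.pos v = (x.pos v).rev := rfl

@[simp] theorem rev_rev (x : WeakPerm n) : x.rev.rev = x :=
  ext_pos fun v => by simp [pos_rev]

theorem rev_isInv {x : WeakPerm n} {b a : Fin n} : x.rev.IsInv b a ↔ a < b ∧ ¬ x.IsInv b a := by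
  have := x.pos_inj (i := a) (j := b)
  simp only [IsInv, pos_rev, Fin.rev_lt_rev]
  grind

theorem rev_le_rev {x y : WeakPerm n} : x.rev ≤ y.rev ↔ y ≤ x := by
  have key : ∀ {x y : WeakPerm n}, y ≤ x → x.rev ≤ y.rev := fun {x y} h => by
    rw [le_iff] at h ⊢
    intro b a
    rw [rev_isInv, rev_isInv]
    exact fun hx => ⟨hx.1, fun hy => hx.2 (h b a hy)⟩
  exact ⟨fun h => by simpa using key h, key⟩

theorem le_rev_iff {x y : WeakPerm n} : x ≤ y.rev ↔ y ≤ x.rev := by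
  rw [← rev_le_rev, rev_rev]

theorem rev_sup (x y : WeakPerm n) : (x ⊔ y).rev = x.rev ⊓ y.rev :=
  eq_of_forall_le_iff fun z => by
    rw [le_inf_iff, le_rev_iff, sup_le_iff, le_rev_iff (x := z), le_rev_iff (x := z)]

instance : Finite (WeakPerm n) :=
  Finite.of_injective perm fun _ _ h => WeakPerm.ext h

theorem Edge.rev {t : ArcTriple n} {y x : WeakPerm n} (h : Edge t y x) :
    Edge t.flip x.rev y.rev where
  isInv_iff v w := by
    have h1 := h.isInv_iff v w
    have h2 := h.not_isInv
    have h3 := t.a_lt_b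
    rw [rev_isInv, rev_isInv]
    simp only [ArcTriple.flip]
    grind
  not_isInv := by
    rw [rev_isInv]
    exact fun h' => h'.2 h.isInv
  left l hl := by
    rw [pos_rev, pos_rev, Fin.rev_lt_rev]
    have hl := ArcTriple.mem_flip_L.1 hl
    have h1 := ArcTriple.lt_of_mem_R hl
    have h2 := h.isInv
    have h3 := h.right l hl
    have h4 := (h.isInv_iff t.b l).1 ⟨h1.2, h2.2.trans h3⟩
    exact (h4.resolve_right fun h' => h1.1.ne' h'.2).2
  right r hr := by
    rw [pos_rev, pos_rev, Fin.rev_lt_rev]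
    have h1 := ArcTriple.mem_L.1 (show r ∈ t.L from hr)
    have h2 := h.isInv
    have h3 := h.left r hr
    have h4 := (h.isInv_iff r t.a).1 ⟨h1.1, h3.trans h2.2⟩
    exact (h4.resolve_right fun h' => h1.2.1.ne h'.1).2

/-! ### Descents and patterns -/

/-- The triple `(b, a, R)`, where `R` collects the values between `a` and `b` that stand to the
right of `a` in `x`. At a descent `b a` of `x` it is the label of the edge going down from `x`. -/
def arcAt (x : WeakPerm n) (b a : Fin n) (h : a < b) : ArcTriple n where
  b := b
  a := a
  R := (Finset.Ioo a b).filter fun v => x.pos a < x.pos v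
  a_lt_b := h
  R_subset := Finset.filter_subset _ _

theorem exists_edge_of_descent {x : WeakPerm n} {i j : Fin n} (hij : i.val + 1 = j.val)
    (h : x.entry j < x.entry i) : ∃ y, Edge (x.arcAt (x.entry i) (x.entry j) h) y x := by
  have hlt : i < j := by simp only [Fin.lt_def]; omega
  let y : WeakPerm n := ⟨(Equiv.swap i j).trans x.perm⟩
  have hy : ∀ k, y.entry k = x.entry (Equiv.swap i j k) := fun k => rfl
  have h1 : y.entry i = x.entry j := by rw [hy, Equiv.swap_apply_left]
  have h3 : x.entry i = y.entry j := by rw [hy, Equiv.swap_apply_right]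
  have h4 : ∀ k, k ≠ i → k ≠ j → y.entry k = x.entry k := fun k hk hk' => by
    rw [hy, Equiv.swap_apply_of_ne_of_ne hk hk']
  refine ⟨y, fun v w => ?_, ?_, ?_, ?_⟩
  · have := Step.isInv_iff hij h1 h h3 h4 v w
    rwa [← h3, h1] at this
  · intro hinv
    have := hinv.2
    simp only [arcAt] at this
    rw [← h1, h3, pos_entry, pos_entry] at this
    exact hlt.not_gt this
  · intro l hl
    simp only [ArcTriple.mem_L, arcAt, Finset.mem_filter, Finset.mem_Ioo, pos_entry] at hl
    have h5 : x.pos l ≠ i := by rintro rfl; simp at hl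
    have h6 : ¬ j < x.pos l := by grind
    have h7 : x.pos l ≠ j := by rintro rfl; simp at hl
    simp only [arcAt, pos_entry]
    grind
  · intro r hr
    simp only [arcAt, Finset.mem_filter] at hr ⊢
    exact hr.2

/-- Below `x` and weakly above a given `y < x` there is an edge at some descent of `x`. -/
theorem exists_edge_of_lt {y x : WeakPerm n} (h : y < x) : ∃ t z, Edge t z x ∧ y ≤ z ∧
    ∃ i j : Fin n, ∃ h : x.entry j < x.entry i, i.val + 1 = j.val ∧
      t = x.arcAt (x.entry i) (x.entry j) h := by
  rcases Relation.ReflTransGen.cases_tail (show Relation.ReflTransGen Step y x from h.le) with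
    h' | ⟨z, hyz, i, j, hij, h1, h2, h3, h4⟩
  · exact absurd h' h.ne'
  · obtain ⟨z', hz'⟩ := exists_edge_of_descent hij h2
    have : z' = z := eq_of_isInv_iff fun v w => by
      have e1 := hz'.isInv_iff v w
      have e2 := Step.isInv_iff hij h1 h2 h3 h4 v w
      have e3 := hz'.not_isInv
      have e4 : ¬ z.IsInv (x.entry i) (x.entry j) := by
        rw [← h1, h3]
        intro hh
        have := hh.2
        simp only [pos_entry, Fin.lt_def] at this
        omega
      simp only [arcAt] at e1 e3
      rw [h3, ← h1] at *
      grind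
    subst this
    exact ⟨_, z', hz', hyz, i, j, h2, hij, rfl⟩

/-- A pattern `t` is a descent whose label has `t` as a subarc. -/
theorem hasPattern_iff {x : WeakPerm n} {t : ArcTriple n} : x.HasPattern t ↔
    ∃ i j : Fin n, ∃ h : x.entry j < x.entry i, i.val + 1 = j.val ∧
      t ≤ x.arcAt (x.entry i) (x.entry j) h := by
  have hab := t.a_lt_b
  have hL := fun v => @ArcTriple.mem_L _ t v
  have hR := fun v => @ArcTriple.lt_of_mem_R _ t v
  constructor
  · rintro ⟨i, j, hij, hlt, hb, ha, h1, h2⟩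
    refine ⟨i, j, hlt, hij, ha, hb, fun v hv => ?_, fun v hv => ?_⟩
    · have := h1 v hv
      simp only [ArcTriple.mem_L, arcAt, Finset.mem_filter, pos_entry, Fin.lt_def] at *
      grind
    · have := h2 v hv
      simp only [arcAt, Finset.mem_filter, pos_entry, Finset.mem_Ioo]
      grind
  · rintro ⟨i, j, hlt, hij, ha, hb, h1, h2⟩
    refine ⟨i, j, hij, hlt, hb, ha, fun v hv => ?_, fun v hv => ?_⟩
    · have hv := h1 hv
      simp only [ArcTriple.mem_L, arcAt, Finset.mem_filter, pos_entry, Finset.mem_Ioo] at hv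
      have h5 : x.pos v ≠ i := by rintro rfl; simp at hv
      have h7 : x.pos v ≠ j := by rintro rfl; simp at hv
      simp only [Fin.lt_def] at *
      grind
    · have := h2 hv
      simp only [arcAt, Finset.mem_filter, pos_entry, Finset.mem_Ioo] at this
      exact this.2

theorem HasPattern.of_le {x : WeakPerm n} {t u : ArcTriple n} (h : x.HasPattern u)
    (htu : t ≤ u) : x.HasPattern t := by
  obtain ⟨i, j, hij, hlt, hb, ha, hL, hR⟩ := h
  exact ⟨i, j, hij, hlt, htu.2.1.trans hb, ha.trans htu.1, fun c hc => hL c (htu.2.2.1 hc),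
    fun c hc => hR c (htu.2.2.2 hc)⟩

/-! ### The congruence attached to an upper set of arcs -/

theorem Sim.refl (C : Set (ArcTriple n)) (x : WeakPerm n) : Sim C x x := fun _ _ => Iff.rfl

theorem Sim.symm {C : Set (ArcTriple n)} {x y : WeakPerm n} (h : Sim C x y) : Sim C y x :=
  fun t ht => (h t ht).symm

theorem Sim.trans {C : Set (ArcTriple n)} {x y z : WeakPerm n} (h : Sim C x y)
    (h' : Sim C y z) : Sim C x z :=
  fun t ht => (h t ht).trans (h' t ht)

theorem Sim.inf {C : Set (ArcTriple n)} {w x y z : WeakPerm n} (h : Sim C w x)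
    (h' : Sim C y z) : Sim C (w ⊓ y) (x ⊓ z) := fun t ht => by
  rw [le_inf_iff, le_inf_iff, h t ht, h' t ht]

theorem Sim.of_le_of_le {C : Set (ArcTriple n)} {x y z : WeakPerm n} (h : Sim C x z)
    (hxy : x ≤ y) (hyz : y ≤ z) : Sim C x y ∧ Sim C y z :=
  ⟨fun t ht => ⟨fun h' => h'.trans hxy, fun h' => (h t ht).2 (h'.trans hyz)⟩,
    fun t ht => ⟨fun h' => h'.trans hyz, fun h' => ((h t ht).2 h').trans hxy⟩⟩

/-- An equivalence relation that contains the edges with labels in `C` contains `Sim C`: the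
`Sim C`-classes are convex and closed under meets, so related elements are joined by a chain of
collapsed edges going through their meet. -/
theorem Sim.rel_of_edge {C : Set (ArcTriple n)} (hC : IsUpperSet C)
    {r : WeakPerm n → WeakPerm n → Prop} (hr : Equivalence r)
    (hedge : ∀ t ∈ C, ∀ y x, Edge t y x → r y x) {x y : WeakPerm n} (h : Sim C x y) : r x y := by
  have key : ∀ {y x : WeakPerm n}, y ≤ x → Sim C y x → r y x := by
    intro y x
    induction x using (Finite.wellFounded_of_trans_of_irrefl
      (fun a b : WeakPerm n => a < b)).induction with
    | _ x ih =>
    intro hle hs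
    rcases hle.eq_or_lt with rfl | hlt
    · exact hr.refl _
    · obtain ⟨t, z, hz, hyz, -⟩ := exists_edge_of_lt hlt
      have hs' := hs.of_le_of_le hyz hz.le
      have hzx : z < x := lt_of_le_of_ne hz.le fun he => hz.not_isInv (he ▸ hz.isInv)
      exact hr.trans (ih z hzx hyz hs'.1) (hedge t ((sim_iff_of_edge hC hz).1 hs'.2) _ _ hz)
  have h1 : Sim C (x ⊓ y) x := by simpa using (Sim.refl C x).inf h.symm
  have h2 : Sim C (x ⊓ y) y := by simpa using h.inf (Sim.refl C y)
  exact hr.trans (hr.symm (key inf_le_left h1)) (key inf_le_right h2)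

/-- Reversal carries `Sim C` to the relation of the same kind for the flipped set of triples, since
it carries edges to edges and both relations are determined by the edges they collapse. -/
theorem Sim.rev {C : Set (ArcTriple n)} (hC : IsUpperSet C)
    {x y : WeakPerm n} (h : Sim C x y) : Sim (ArcTriple.flip ⁻¹' C) x.rev y.rev := by
  refine h.rel_of_edge hC (r := fun x y => Sim (ArcTriple.flip ⁻¹' C) x.rev y.rev)
    ⟨fun _ => Sim.refl _ _, Sim.symm, Sim.trans⟩ fun t ht y x he => ?_
  refine ((sim_iff_of_edge (fun u v huv hu => ?_) he.rev).2 ?_).symm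
  · exact hC (ArcTriple.flip_le_flip huv) hu
  · simpa using ht

/-- The relation `Sim C` as a lattice congruence. Compatibility with meets is immediate, and
compatibility with joins is compatibility with meets after reversal. -/
def con (C : Set (ArcTriple n)) (hC : IsUpperSet C) :
    LatticeCon (WeakPerm n) where
  r := Sim C
  iseqv := ⟨Sim.refl C, Sim.symm, Sim.trans⟩
  inf := Sim.inf
  sup {w x y z} h h' := by
    have hC' : IsUpperSet (ArcTriple.flip ⁻¹' C) :=
      fun u v huv hu => hC (ArcTriple.flip_le_flip huv) hu
    have := ((h.rev hC).inf (h'.rev hC)).rev hC'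
    rw [← rev_sup, ← rev_sup, rev_rev, rev_rev, ← Set.preimage_comp] at this
    have hf : (ArcTriple.flip ∘ ArcTriple.flip : ArcTriple n → ArcTriple n) = id :=
      funext ArcTriple.flip_flip
    rwa [hf, Set.preimage_id] at this

/-! ### Forcing between join-irreducibles -/

/-- Every permutation strictly below `λ(b, a, R)` lacks the inversion `(b, a)`: together with the
non-inversions of `λ(b, a, R)`, this inversion implies all others. -/
theorem not_isInv_of_lt_joinIrr {t : ArcTriple n} {w : WeakPerm n} (h : w < t.joinIrr) :
    ¬ w.IsInv t.b t.a := by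
  intro hinv
  refine h.not_ge (ArcTriple.joinIrr_le_iff.2 fun l r hl hr hrl => ⟨hrl, ?_⟩)
  have hle := le_iff.1 h.le
  have h1 : w.pos l ≤ w.pos t.b := by
    rcases hl with hl | rfl
    · have hl' := ArcTriple.mem_L.1 hl
      refine (isInv_of_not_isInv hl'.2.1 fun hb => ?_).le
      have := ArcTriple.joinIrr_isInv.1 (hle _ _ hb)
      have hab := t.a_lt_b
      unfold ArcTriple.block at this
      grind
    · exact le_rfl
  have h2 : w.pos t.a ≤ w.pos r := by
    rcases hr with hr | rfl
    · have hr' := ArcTriple.lt_of_mem_R hr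
      refine (isInv_of_not_isInv hr'.1 fun hb => ?_).le
      have := ArcTriple.joinIrr_isInv.1 (hle _ _ hb)
      have hab := t.a_lt_b
      unfold ArcTriple.block at this
      grind
    · exact le_rfl
  exact h1.trans_lt (hinv.2.trans_le h2)

theorem Edge.le_of_le_of_not_isInv {t : ArcTriple n} {y x w : WeakPerm n} (h : Edge t y x)
    (hw : w ≤ x) (h' : ¬ w.IsInv t.b t.a) : w ≤ y :=
  le_iff.2 fun u v huv => ((h.isInv_iff u v).1 (le_iff.1 hw u v huv)).resolve_right
    (by rintro ⟨rfl, rfl⟩; exact h' huv)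

theorem Edge.le_of_le_of_isInv {t : ArcTriple n} {y x w : WeakPerm n} (h : Edge t y x)
    (hw : y ≤ w) (h' : w.IsInv t.b t.a) : x ≤ w :=
  le_iff.2 fun u v huv => ((h.isInv_iff u v).1 huv).elim (le_iff.1 hw u v)
    (by rintro ⟨rfl, rfl⟩; exact h')

/-- A congruence contracting `λ(t)` collapses every edge `y ⋖ x` labelled `t`, because `x` is the
join of `y` and `λ(t)`, and everything strictly below `λ(t)` is below `y`. -/
theorem Contracted.rel_of_edge {Θ : LatticeCon (WeakPerm n)} {t : ArcTriple n}
    (ht : Contracted Θ t.joinIrr) {y x : WeakPerm n} (h : Edge t y x) : Θ.r y x := by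
  obtain ⟨w, hw, hr⟩ := ht
  have hwy : w ≤ y := h.le_of_le_of_not_isInv (hw.le.trans h.joinIrr_le)
    (not_isInv_of_lt_joinIrr hw)
  have hx : y ⊔ t.joinIrr = x := le_antisymm (sup_le h.le h.joinIrr_le)
    (h.le_of_le_of_isInv le_sup_left
      (ArcTriple.joinIrr_le_iff.1 le_sup_right _ _ (Or.inr rfl) (Or.inr rfl) t.a_lt_b))
  have := Θ.sup (Θ.refl y) hr
  rw [hx, sup_eq_left.2 hwy] at this
  exact Θ.symm this

theorem Edge.contracted_of_rel {Θ : LatticeCon (WeakPerm n)} {t : ArcTriple n}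
    {y x : WeakPerm n} (h : Edge t y x) (hr : Θ.r y x) : Contracted Θ t.joinIrr := by
  refine ⟨t.joinIrr ⊓ y, inf_lt_left.2 (not_joinIrr_le h.not_isInv), ?_⟩
  have := Θ.inf (Θ.refl t.joinIrr) (Θ.symm hr)
  rwa [inf_eq_left.2 h.joinIrr_le] at this

/-- Two block permutations whose block functions order all pairs alike, except for the pair `t.b`,
`t.a`, form an edge labelled `t`. -/
theorem edge_of_blocks {t : ArcTriple n} {c d : Fin n → ℕ} {y x : WeakPerm n}
    (hy : ∀ b a, y.IsInv b a ↔ a < b ∧ c b < c a) (hx : ∀ b a, x.IsInv b a ↔ a < b ∧ d b < d a)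
    (hne : ∀ b a, a < b → (b ≠ t.b ∨ a ≠ t.a) → (c b < c a ↔ d b < d a))
    (hc : c t.a < c t.b) (hd : d t.b < d t.a)
    (hL : ∀ l ∈ t.L, d l ≤ d t.b) (hR : ∀ r ∈ t.R, d t.a ≤ d r) : Edge t y x where
  isInv_iff v w := by
    have := t.a_lt_b
    have := hne v w
    rw [hx, hy]
    grind
  not_isInv := by
    rw [hy]
    grind
  left l hl := by
    have := hL l hl
    exact isInv_of_not_isInv (ArcTriple.mem_L.1 hl).2.1 (by rw [hx]; grind)
  right r hr := by
    have := hR r hr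
    exact isInv_of_not_isInv (ArcTriple.lt_of_mem_R hr).1 (by rw [hx]; grind)

/-- Forcing by joins. Write `t = (b, a, R)` and `u = (q, p, R')`. With `y = ⋯ a p q b ⋯` (possibly
`a = p` or `q = b`), where the other left values of `u` come before and the other right values
after these four, the join `y ⊔ λ(t)` reverses `p q` through the chain `q, b, a, p`, whereas
joining `y` with anything strictly below `λ(t)` gives `y`. So the edge labelled `u` going up from
`y` is collapsed. -/
theorem Contracted.of_le_of_join {Θ : LatticeCon (WeakPerm n)} {t u : ArcTriple n}
    (ht : Contracted Θ t.joinIrr) (htu : t ≤ u) (ha : t.a ∈ u.L ∨ t.a = u.a)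
    (hb : t.b ∈ u.R ∨ t.b = u.b) : Contracted Θ u.joinIrr := by
  obtain ⟨h1, h2, h3, h4⟩ := htu
  have hab := t.a_lt_b
  have hLu := fun v => @ArcTriple.mem_L _ u v
  have hRu := fun v => @ArcTriple.lt_of_mem_R _ u v
  have hLt := fun v => @ArcTriple.mem_L _ t v
  have hRt := fun v => @ArcTriple.lt_of_mem_R _ t v
  obtain ⟨y, hy⟩ := exists_isInv_iff_blocks fun v => if v < u.a then 0 else if u.b < v then 7
    else if v = u.a then 3 else if v = u.b then 4 else if v = t.a then 2 else if v = t.b then 5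
    else if v ∈ u.R then 6 else 1
  obtain ⟨x, hx⟩ := exists_isInv_iff_blocks fun v => if v < u.a then 0 else if u.b < v then 7
    else if v = u.a then 4 else if v = u.b then 3 else if v = t.a then 2 else if v = t.b then 5
    else if v ∈ u.R then 6 else 1
  have he : Edge u y x := by
    refine edge_of_blocks hy hx ?_ ?_ ?_ ?_ ?_ <;> clear hx hy <;> grind (splits := 40)
  refine Edge.contracted_of_rel he ?_
  obtain ⟨w, hw, hr⟩ := ht
  have hwy : w ≤ y := by
    refine le_iff.2 fun l r hlr => ?_
    have hne := not_isInv_of_lt_joinIrr hw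
    have hj := ArcTriple.joinIrr_isInv.1 (le_iff.1 hw.le _ _ hlr)
    unfold ArcTriple.block at hj
    have hne' : l ≠ t.b ∨ r ≠ t.a := by grind
    rw [hy]
    clear hx hy
    grind (splits := 40)
  have hxs : x ≤ y ⊔ t.joinIrr := by
    refine he.le_of_le_of_isInv le_sup_left ⟨u.a_lt_b, ?_⟩
    have e1 := (ArcTriple.joinIrr_le_iff.1 (le_sup_right : t.joinIrr ≤ y ⊔ t.joinIrr) _ _
      (Or.inr rfl) (Or.inr rfl) t.a_lt_b).2
    have hle := le_iff.1 (le_sup_left : y ≤ y ⊔ t.joinIrr)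
    have e2 : (y ⊔ t.joinIrr).pos u.b ≤ (y ⊔ t.joinIrr).pos t.b := by
      rcases hb with hb | hb
      · exact (hle u.b t.b ((hy _ _).2 (by grind))).2.le
      · rw [hb]
    have e3 : (y ⊔ t.joinIrr).pos t.a ≤ (y ⊔ t.joinIrr).pos u.a := by
      rcases ha with ha | ha
      · exact (hle t.a u.a ((hy _ _).2 (by grind))).2.le
      · rw [ha]
    exact e2.trans_lt (e1.trans_le e3)
  have h5 := Θ.inf (Θ.refl x) (Θ.sup (Θ.refl y) hr)
  rw [inf_eq_left.2 hxs, sup_eq_left.2 hwy, inf_eq_right.2 he.le] at h5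
  exact Θ.symm h5

/-- Forcing by meets. Write `t = (b, a, R)` and `u = (q, p, R')`. With `x = ⋯ b q p a ⋯` (possibly
`b = q` or `p = a`) and the edge from `y' = ⋯ q a b p ⋯` to `x' = ⋯ q b a p ⋯`, labelled `t`, we
have `x ≤ x'`, whereas in `x ⊓ y'` the order `p, a, b, q` is forced. So the edge labelled `u` going
down from `x` is collapsed. -/
theorem Contracted.of_le_of_meet {Θ : LatticeCon (WeakPerm n)} {t u : ArcTriple n}
    (ht : Contracted Θ t.joinIrr) (htu : t ≤ u) (ha : t.a ∈ u.R ∨ t.a = u.a)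
    (hb : t.b ∈ u.L ∨ t.b = u.b) : Contracted Θ u.joinIrr := by
  obtain ⟨h1, h2, h3, h4⟩ := htu
  have hab := t.a_lt_b
  have hLu := fun v => @ArcTriple.mem_L _ u v
  have hRu := fun v => @ArcTriple.lt_of_mem_R _ u v
  have hLt := fun v => @ArcTriple.mem_L _ t v
  have hRt := fun v => @ArcTriple.lt_of_mem_R _ t v
  obtain ⟨y, hy⟩ := exists_isInv_iff_blocks fun v => if v < u.a then 0 else if u.b < v then 7
    else if v = u.a then 3 else if v = u.b then 4 else if v = t.a then 5 else if v = t.b then 2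
    else if v ∈ u.R then 6 else 1
  obtain ⟨x, hx⟩ := exists_isInv_iff_blocks fun v => if v < u.a then 0 else if u.b < v then 7
    else if v = u.a then 4 else if v = u.b then 3 else if v = t.a then 5 else if v = t.b then 2
    else if v ∈ u.R then 6 else 1
  obtain ⟨y', hy'⟩ := exists_isInv_iff_blocks fun v => if v < u.a then 0 else if u.b < v then 7
    else if v = t.a then 3 else if v = t.b then 4 else if v = u.a then 5 else if v = u.b then 2
    else if v ∈ u.R then 6 else 1
  obtain ⟨x', hx'⟩ := exists_isInv_iff_blocks fun v => if v < u.a then 0 else if u.b < v then 7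
    else if v = t.a then 4 else if v = t.b then 3 else if v = u.a then 5 else if v = u.b then 2
    else if v ∈ u.R then 6 else 1
  have he : Edge u y x := by
    refine edge_of_blocks hy hx ?_ ?_ ?_ ?_ ?_ <;> clear hx hy <;> grind (splits := 40)
  have he' : Edge t y' x' := by
    refine edge_of_blocks hy' hx' ?_ ?_ ?_ ?_ ?_ <;> clear hx hy hx' hy' <;> grind (splits := 40)
  refine Edge.contracted_of_rel he ?_
  have hr := Contracted.rel_of_edge ht he'
  have hxx : x ≤ x' := by
    refine le_iff.2 fun v w hvw => ?_
    rw [hx] at hvw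
    rw [hx']
    clear hx hy hx' hy'
    grind (splits := 40)
  have hxy : x ⊓ y' ≤ y := by
    refine he.le_of_le_of_not_isInv inf_le_left fun hinv => ?_
    have hle := le_iff.1 (inf_le_left : x ⊓ y' ≤ x)
    have hle' := le_iff.1 (inf_le_right : x ⊓ y' ≤ y')
    have e1 := isInv_of_not_isInv (x := x ⊓ y') t.a_lt_b fun h =>
      absurd ((hy' _ _).1 (hle' _ _ h)) (by grind)
    have e2 : (x ⊓ y').pos t.b ≤ (x ⊓ y').pos u.b := by
      rcases hb with hb | hb
      · exact (isInv_of_not_isInv (hLu _ |>.1 hb).2.1 fun h =>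
          absurd ((hx _ _).1 (hle _ _ h)) (by grind)).le
      · rw [hb]
    have e3 : (x ⊓ y').pos u.a ≤ (x ⊓ y').pos t.a := by
      rcases ha with ha | ha
      · exact (isInv_of_not_isInv (hRu _ ha).1 fun h =>
          absurd ((hx _ _).1 (hle _ _ h)) (by grind)).le
      · rw [ha]
    exact absurd hinv.2 (e3.trans_lt (e1.trans_le e2)).not_gt
  have h5 := Θ.sup (Θ.refl y) (Θ.inf (Θ.refl x) hr)
  rwa [sup_eq_left.2 hxy, inf_eq_left.2 hxx, sup_eq_right.2 he.le] at h5

/-- The forcing relation: a congruence contracting `λ(t)` contracts `λ(u)` for every `u` of which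
`t` is a subarc. The two endpoints are moved one after the other, each by a join or a meet
depending on the side of `u` on which the old endpoint lies. -/
theorem Contracted.of_le {Θ : LatticeCon (WeakPerm n)} {t u : ArcTriple n}
    (ht : Contracted Θ t.joinIrr) (htu : t ≤ u) : Contracted Θ u.joinIrr := by
  have hab := t.a_lt_b
  have hLu := fun v => @ArcTriple.mem_L _ u v
  have hRu := fun v => @ArcTriple.lt_of_mem_R _ u v
  have hLt := fun v => @ArcTriple.mem_L _ t v
  have hRt := fun v => @ArcTriple.lt_of_mem_R _ t v
  obtain ⟨h1, h2, h3, h4⟩ := htu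
  -- The intermediate arc has the upper endpoint of `t` and the lower endpoint of `u`.
  let m : ArcTriple n := ⟨t.b, u.a, u.R ∩ Finset.Ioo u.a t.b, h1.trans_lt hab,
    Finset.inter_subset_right⟩
  have hmL : ∀ v, v ∈ m.L ↔ v ∈ u.L ∧ v < t.b := fun v => by
    simp only [ArcTriple.mem_L, m, Finset.mem_inter, Finset.mem_Ioo]
    grind
  have hmR : ∀ v, v ∈ m.R ↔ v ∈ u.R ∧ v < t.b := fun v => by
    simp only [m, Finset.mem_inter, Finset.mem_Ioo]
    grind
  have htm : t ≤ m := ⟨h1, le_rfl, fun v hv => (hmL v).2 (by grind),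
    fun v hv => (hmR v).2 (by grind)⟩
  have hmu : m ≤ u := ⟨le_rfl, h2, fun v hv => ((hmL v).1 hv).1, fun v hv => ((hmR v).1 hv).1⟩
  have hm : Contracted Θ m.joinIrr := by
    by_cases ha : t.a ∈ u.R
    · exact ht.of_le_of_meet htm (Or.inl ((hmR _).2 ⟨ha, hab⟩)) (Or.inr rfl)
    · refine ht.of_le_of_join htm ?_ (Or.inr rfl)
      rw [hmL, hLu]
      rcases h1.eq_or_lt with h | h
      · exact Or.inr h.symm
      · exact Or.inl ⟨⟨h, hab.trans_le h2, ha⟩, hab⟩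
  by_cases hb : t.b ∈ u.R
  · exact hm.of_le_of_join hmu (Or.inr rfl) (Or.inl hb)
  · refine hm.of_le_of_meet hmu (Or.inr rfl) ?_
    rw [hLu]
    rcases h2.eq_or_lt with h | h
    · exact Or.inr h
    · exact Or.inl ⟨h1.trans_lt hab, h, hb⟩

/-! ### Contracted permutations and pattern avoidance -/

theorem contracted_con_iff {C : Set (ArcTriple n)} (hC : IsUpperSet C)
    {x : WeakPerm n} : Contracted (con C hC) x ↔ ∃ t ∈ C, x.HasPattern t := by
  constructor
  · rintro ⟨y, hlt, hr⟩
    obtain ⟨t, z, hz, hyz, i, j, h, hij, rfl⟩ := exists_edge_of_lt hlt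
    have hs := (Sim.of_le_of_le (Sim.symm hr) hyz hz.le).2
    exact ⟨_, (sim_iff_of_edge hC hz).1 hs, hasPattern_iff.2
      ⟨i, j, h, hij, le_rfl⟩⟩
  · rintro ⟨t, ht, hx⟩
    obtain ⟨i, j, h, hij, hle⟩ := hasPattern_iff.1 hx
    obtain ⟨y, hy⟩ := exists_edge_of_descent hij h
    exact ⟨y, lt_of_le_of_ne hy.le fun he => hy.not_isInv (he ▸ hy.isInv),
      Sim.symm ((sim_iff_of_edge hC hy).2 (hC hle ht))⟩

theorem hasPattern_joinIrr (t : ArcTriple n) : t.joinIrr.HasPattern t := by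
  have hab := t.a_lt_b
  have hba : t.joinIrr.IsInv t.b t.a :=
    ArcTriple.joinIrr_le_iff.1 le_rfl _ _ (Or.inr rfl) (Or.inr rfl) hab
  -- A single block gives the identity permutation, which has no inversions.
  obtain ⟨y, hy⟩ := exists_isInv_iff_blocks fun _ : Fin n => 0
  simp only [lt_irrefl, and_false, iff_false] at hy
  have hlt : y < t.joinIrr := lt_of_le_of_ne (le_iff.2 fun b a h => absurd h (hy b a))
    fun he => hy _ _ (he ▸ hba)
  -- The edge going down from `λ(t)` has to remove the inversion `(b, a)`, so its label is `t`.
  obtain ⟨u, z, hz, -, i, j, h, hij, rfl⟩ := exists_edge_of_lt hlt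
  have hzlt : z < t.joinIrr := lt_of_le_of_ne hz.le fun he => hz.not_isInv (he ▸ hz.isInv)
  obtain ⟨hb, ha⟩ := ((hz.isInv_iff _ _).1 hba).resolve_left (not_isInv_of_lt_joinIrr hzlt)
  refine hasPattern_iff.2 ⟨i, j, h, hij, ha.ge, hb.le, fun l hl => ?_, fun r hr => ?_⟩
  · have hl' := ArcTriple.mem_L.1 hl
    have hinv := ArcTriple.joinIrr_le_iff.1 le_rfl l t.a (Or.inl hl) (Or.inr rfl) hl'.1
    refine ArcTriple.mem_L.2 ⟨ha ▸ hl'.1, hb ▸ hl'.2.1, fun hR => ?_⟩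
    have hR := (Finset.mem_filter.1 hR).2
    rw [show t.joinIrr.entry j = t.a from ha.symm] at hR
    exact hR.not_gt hinv.2
  · have hr' := ArcTriple.lt_of_mem_R hr
    refine Finset.mem_filter.2 ⟨Finset.mem_Ioo.2 ⟨ha.symm.trans_lt hr'.1, hr'.2.trans_eq hb⟩, ?_⟩
    rw [show t.joinIrr.entry j = t.a from ha.symm]
    refine isInv_of_not_isInv hr'.1 fun hra => ?_
    have := ArcTriple.joinIrr_isInv.1 hra
    unfold ArcTriple.block at this
    grind

end WeakPerm

theorem mainTheorem8 (n : ℕ) {I : Type*} (t : I → ArcTriple n) :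
    (∃ Θ : LatticeCon (WeakPerm n),
      WeakPerm.IsSmallestContracting Θ (Set.range fun i => (t i).joinIrr)) ∧
    ∀ Θ : LatticeCon (WeakPerm n),
      WeakPerm.IsSmallestContracting Θ (Set.range fun i => (t i).joinIrr) →
      ∀ x : WeakPerm n, ¬ WeakPerm.Contracted Θ x ↔ ∀ i, x.Avoids (t i) := by
  -- The upper set generated by the family in the subarc order.
  let C : Set (ArcTriple n) := {u | ∃ i, t i ≤ u}
  have hC : IsUpperSet C := fun u v huv ⟨i, hi⟩ => ⟨i, hi.trans huv⟩
  have hmem : ∀ i, t i ∈ C := fun i => ⟨i, le_rfl⟩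
  have hsmall : WeakPerm.IsSmallestContracting (WeakPerm.con C hC)
      (Set.range fun i => (t i).joinIrr) := by
    constructor
    · rintro _ ⟨i, rfl⟩
      exact (WeakPerm.contracted_con_iff hC).2 ⟨t i, hmem i, WeakPerm.hasPattern_joinIrr _⟩
    · intro Θ' hΘ' x y hxy
      refine WeakPerm.Sim.rel_of_edge hC Θ'.iseqv ?_ hxy
      rintro u ⟨i, hi⟩ y x he
      exact WeakPerm.Contracted.rel_of_edge
        (WeakPerm.Contracted.of_le (hΘ' _ ⟨i, rfl⟩) hi) he
  refine ⟨⟨_, hsmall⟩, fun Θ hΘ x => ?_⟩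
  have hcon : WeakPerm.Contracted Θ x ↔ WeakPerm.Contracted (WeakPerm.con C hC) x :=
    ⟨fun ⟨y, hy, hr⟩ => ⟨y, hy, hΘ.2 _ hsmall.1 _ _ hr⟩,
      fun ⟨y, hy, hr⟩ => ⟨y, hy, hsmall.2 _ hΘ.1 _ _ hr⟩⟩
  rw [hcon, WeakPerm.contracted_con_iff, not_exists]
  constructor
  · exact fun h i hi => h (t i) ⟨hmem i, hi⟩
  · rintro h u ⟨⟨i, hi⟩, hu⟩
    exact h i (hu.of_le hi)
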